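/- Let $R$ be a factorial domain with quotient field $K$, and let $\mathrm{Int}(R)=\{g\in K[X] : g(c)\in R \text{ for all } c\in R\}$. Let $f\in R[X]$ be nonzero and let $[\![f]\!]$ be the smallest divisor-closed submonoid of $\mathrm{Int}(R)\setminus\{0\}$ containing $f$ (a submonoid $T$ is divisor-closed if $xy\in T$ implies $x\in T$). Fix a system $Q$ of representatives, up to associates, of the irreducible elements of $R$, and let $v_p$ be the $p$-adic valuation. For $g\in\mathrm{Int}(R)\setminus\{0\}$ put $d(g)=\prod_{p\in Q}p^{\min\{v_p(g(c)) : c\in R\}}$, and for $g\in[\![f]\!]$ put $e_f(g)=\prod_{p\in Q}p^{\max\{v_p(d(gh)/d(h)) : h\in[\![f]\!]\}}$. For a commutative cancellative monoid $H$ with quotient group $L$ and $Y\subseteq L$ let $Y^{-1}=\{z\in L: zY\subseteq H\}$; a subset $I\subseteq H$ is a $v$-ideal if $(I^{-1})^{-1}=I$. A prime ideal of $H$ is a proper subset $P\subsetneq H$ with $PH=P$ such that $xy\in P$ implies $x\in P$ or $y\in P$; a height-one prime is a minimal nonempty prime ideal. (1) For every $g\in[\![f]\!]$, $$gK[X]\cap[\![f]\!]=\tfrac{g}{e_f(g)}[\![f]\!]\cap[\![f]\!].$$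 This set is a $v$-ideal of $[\![f]\!]$, and if $g$ is irreducible in $K[X]$, it is a height-one prime of $[\![f]\!]$. (2) The set of height-one primes $P$ of $[\![f]\!]$ with $P\cap R=\emptyset$ is equal to $\{tK[X]\cap[\![f]\!] : t\in\mathcal T\}$, where $\mathcal T$ is the set of all $t\in[\![f]\!]\cap R[X]$ that are irreducible in $R[X]$ and not in $R$, and it is also equal to $\{gK[X]\cap[\![f]\!] : g\in[\![f]\!],\ g \text{ irreducible in } K[X]\}$. Moreover, $\mathcal T$ is the set of nonconstant irreducible factors of $f$ in $R[X]$, and for every system $\mathcal R$ of representatives of $\mathcal T$ up to associates, $t\mapsto tK[X]\cap[\![f]\!]$ is a bijection from $\mathcal R$ onto the set of height-one primes $P$ of $[\![f]\!]$ with $P\cap R=\emptyset$. -/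

import Mathlib

open Polynomial
open scoped Pointwise

namespace MonadicInt

noncomputable section

section Monoid

variable {H : Type*} [CommMonoid H]

/-- `T` is a divisor-closed submonoid of `H`. -/
def IsDivisorClosed (T : Submonoid H) : Prop :=
  ∀ x y : H, x * y ∈ T → x ∈ T

/-- The smallest divisor-closed submonoid `[[E]]` of `H` containing `E`. -/
def divisorClosure (E : Set H) : Submonoid H :=
  sInf {T : Submonoid H | IsDivisorClosed T ∧ E ⊆ T}

/-- `I` is an `s`-ideal of `H`: `I H = I`. The empty set is allowed. -/
def IsSIdeal (I : Set H) : Prop :=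
  I * Set.univ = I

/-- `P` is a prime `s`-ideal of `H`. -/
def IsPrimeSIdeal (P : Set H) : Prop :=
  IsSIdeal P ∧ P ≠ Set.univ ∧ ∀ x y : H, x * y ∈ P → x ∈ P ∨ y ∈ P

/-- The set of height-one prime ideals of `H`, i.e. of minimal nonempty prime `s`-ideals. -/
def heightOnePrimes (H : Type*) [CommMonoid H] : Set (Set H) :=
  {P | Minimal (fun I : Set H => IsPrimeSIdeal I ∧ I.Nonempty) P}

/-- `Y⁻¹ = {z | z Y ⊆ H}` for a subset `Y` of the quotient group of `H`. -/
def fracInv (Y : Set (Algebra.GrothendieckGroup H)) : Set (Algebra.GrothendieckGroup H) :=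
  {z | ∀ y ∈ Y, z * y ∈ Set.range (Algebra.GrothendieckGroup.of (M := H))}

/-- `I ⊆ H` is a divisorial ideal (`v`-ideal) of `H`: `(I⁻¹)⁻¹ = I` in the quotient group. -/
def IsVIdeal (I : Set H) : Prop :=
  fracInv (fracInv (Algebra.GrothendieckGroup.of '' I)) = Algebra.GrothendieckGroup.of '' I

/-- `F` is a system of representatives of `E`, up to associates in `H`. -/
def IsRepSystem (F E : Set H) : Prop :=
  F ⊆ E ∧ ∀ x ∈ E, ∃! y, y ∈ F ∧ Associated x y

end Monoid

section IntegerValued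

variable (R K : Type*) [CommRing R] [IsDomain R] [Field K] [Algebra R K]

/-- The ring `Int(R)` of integer-valued polynomials over `R`. -/
def integerValued : Subring K[X] where
  carrier := {g | ∀ c : R, g.eval (algebraMap R K c) ∈ (algebraMap R K).range}
  mul_mem' := fun ha hb c => by
    rw [eval_mul]
    exact mul_mem (ha c) (hb c)
  one_mem' := fun c => by
    rw [eval_one]
    exact one_mem _
  add_mem' := fun ha hb c => by
    rw [eval_add]
    exact add_mem (ha c) (hb c)
  zero_mem' := fun c => by
    rw [eval_zero]
    exact zero_mem _
  neg_mem' := fun ha c => by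
    rw [eval_neg]
    exact neg_mem (ha c)

/-- The multiplicative monoid of nonzero integer-valued polynomials over `R`. -/
def nonzeroInt : Submonoid K[X] where
  carrier := {g | g ∈ integerValued R K ∧ g ≠ 0}
  mul_mem' := fun ha hb => ⟨mul_mem ha.1 hb.1, mul_ne_zero ha.2 hb.2⟩
  one_mem' := ⟨one_mem _, one_ne_zero⟩

variable {R}

/-- A nonzero polynomial over `R`, viewed as a nonzero integer-valued polynomial. -/
def ofPoly [IsFractionRing R K] (f : R[X]) (hf : f ≠ 0) : nonzeroInt R K :=
  ⟨f.map (algebraMap R K), fun c => ⟨f.eval c, by rw [eval_map_apply]⟩,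
    (Polynomial.map_ne_zero_iff (IsFractionRing.injective R K)).2 hf⟩

variable {K}

/-- The monadic submonoid `[[f]]` of the monoid of nonzero integer-valued polynomials, as a
submonoid of `K[X]`. -/
def monadic (f : nonzeroInt R K) : Submonoid K[X] :=
  (divisorClosure {f}).map (nonzeroInt R K).subtype

/-- The exponent `min {v_p (g(c)) | c ∈ R}`. -/
def minVal (g : K[X]) (p : R) : ℕ :=
  (sInf {n : ℕ∞ | ∃ c r : R,
    algebraMap R K r = g.eval (algebraMap R K c) ∧ n = emultiplicity p r}).toNat

/-- The fixed divisor `d_Q(g) = ∏_{p ∈ Q} p ^ min {v_p (g(c)) | c ∈ R}`. -/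
def fixedDivisor (Q : Set R) (g : K[X]) : R :=
  ∏ᶠ p ∈ Q, p ^ minVal g p

/-- The exponent `max {v_p (d(gh) / d(h)) | h ∈ [[f]]}`; here `c` is the quotient
`d(gh) / d(h)`. -/
def maxVal (Q : Set R) (f : nonzeroInt R K) (g : K[X]) (p : R) : ℕ :=
  sSup {n : ℕ | ∃ h ∈ monadic f, ∃ c : R,
    c * fixedDivisor Q h = fixedDivisor Q (g * h) ∧ emultiplicity p c = n}

/-- `e_{f,Q}(g) = ∏_{p ∈ Q} p ^ max {v_p (d(gh) / d(h)) | h ∈ [[f]]}`. -/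
def eElem (Q : Set R) (f : nonzeroInt R K) (g : K[X]) : R :=
  ∏ᶠ p ∈ Q, p ^ maxVal Q f g p

/-- The contraction `g K[X] ∩ [[f]]`, as a subset of the monoid `[[f]]`. -/
def contraction (f : nonzeroInt R K) (g : K[X]) : Set (monadic f) :=
  {z | (z : K[X]) ∈ Ideal.span {g}}

/-- The height-one prime ideals `P` of `[[f]]` with `P ∩ R = ∅`. -/
def primesAvoidingConstants (f : nonzeroInt R K) : Set (Set (monadic f)) :=
  {P | P ∈ heightOnePrimes (monadic f) ∧ ∀ z ∈ P, ∀ r : R, (z : K[X]) ≠ C (algebraMap R K r)}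

/-- The set `([[f]] ∩ A(R[X])) \ R`: irreducible nonconstant polynomials over `R` lying in
`[[f]]`. -/
def nonconstantAtoms (f : nonzeroInt R K) : Set R[X] :=
  {t | t.map (algebraMap R K) ∈ monadic f ∧ Irreducible t ∧ ∀ r : R, t ≠ C r}

end IntegerValued

end

end MonadicInt

/-! Everything rests on one fact: `e_f(g)` is a common denominator. If `g` divides `z` in `K[X]` and
both lie in `[[f]]`, then `e_f(g) z / g` again lies in `[[f]]` (`C_eElem_mul_mem_monadic`).

For this the maximum defining `e_f(g)` must be finite (`exists_minVal_mul_le`). Up to constants,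
each `h` in `[[f]]` is a product of irreducible factors `t` of `f`, so `v_p(h(c))` is monotone in
the vector of the `v_p(t(c))`. By Dickson's lemma finitely many points `c'` with `g(c') ≠ 0` lie
below all points where `g` does not vanish, and the values `v_p(g(c'))` bound `v_p(d(gh)/d(h))`
uniformly in `h`.

The rest is formal. Since `1` and `e_f(g)/g` lie in the inverse of `gK[X] ∩ [[f]]`, this set is a
`v`-ideal. A nonempty prime ideal `P` contains `f`, hence an irreducible factor `t` of `f`. If `P`
avoids constants, then `e_f(t) z ∈ t[[f]] ⊆ P` forces `z ∈ P`, so `tK[X] ∩ [[f]] ⊆ P`. Gauss's lemma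
passes between `R[X]` and `K[X]`. -/

namespace MonadicInt

/-! ### Divisor closures and prime `s`-ideals -/

section Monoid

variable {H : Type*} [CommMonoid H]

theorem isDivisorClosed_divisorClosure (E : Set H) : IsDivisorClosed (divisorClosure E) := by
  intro x y hxy
  refine Submonoid.mem_sInf.2 fun T hT => hT.1 x y ?_
  exact Submonoid.mem_sInf.1 hxy T hT

theorem mem_divisorClosure_singleton {x y : H} : x ∈ divisorClosure {y} ↔ ∃ n : ℕ, x ∣ y ^ n := by
  constructor
  · intro hx
    let T : Submonoid H :=
      { carrier := {z | ∃ n : ℕ, z ∣ y ^ n}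
        one_mem' := ⟨0, one_dvd _⟩
        mul_mem' := fun {a b} ⟨m, hm⟩ ⟨n, hn⟩ =>
          ⟨m + n, (pow_add y m n).symm ▸ mul_dvd_mul hm hn⟩ }
    refine Submonoid.mem_sInf.1 hx T ⟨?_, ?_⟩
    · rintro a b ⟨n, hn⟩
      exact ⟨n, (dvd_mul_right a b).trans hn⟩
    · rintro z rfl
      exact ⟨1, (pow_one z).symm ▸ dvd_rfl⟩
  · rintro ⟨n, z, hz⟩
    refine isDivisorClosed_divisorClosure {y} x z ?_
    rw [← hz]
    exact pow_mem (Submonoid.mem_sInf.2 fun T hT => hT.2 rfl) n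

theorem IsPrimeSIdeal.mul_mem_right {P : Set H} (hP : IsPrimeSIdeal P) {x : H} (hx : x ∈ P)
    (y : H) : x * y ∈ P := by
  have h : x * y ∈ P * Set.univ := Set.mul_mem_mul hx (Set.mem_univ y)
  rwa [hP.1] at h

theorem IsPrimeSIdeal.one_notMem {P : Set H} (hP : IsPrimeSIdeal P) : (1 : H) ∉ P := by
  intro h
  refine hP.2.1 (Set.eq_univ_of_forall fun x => ?_)
  simpa using hP.mul_mem_right h x

theorem IsPrimeSIdeal.mem_of_pow_mem {P : Set H} (hP : IsPrimeSIdeal P) {x : H} {n : ℕ}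
    (h : x ^ n ∈ P) : x ∈ P := by
  induction n with
  | zero => exact absurd (by simpa using h) hP.one_notMem
  | succ n ih =>
    rw [pow_succ] at h
    exact (hP.2.2 _ _ h).elim ih id

end Monoid

/-! ### Values of integer-valued polynomials and their minimal valuations -/

section Values

variable {R K : Type*} [CommRing R] [Field K] [Algebra R K]

theorem infinite_of_prime [IsDomain R] {p : R} (hp : Prime p) : Infinite R := by
  by_contra h
  rw [not_infinite_iff_finite] at h
  obtain ⟨b, hb⟩ := (Finite.isField_of_domain R).mul_inv_cancel hp.ne_zero
  exact hp.not_isUnit (IsUnit.of_mul_eq_one b hb)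

/-- The value of an integer-valued polynomial at an element of the base ring, as an element of the
base ring. -/
noncomputable def intValue (g : K[X]) (c : R) : R :=
  Function.invFun (algebraMap R K) (g.eval (algebraMap R K c))

theorem algebraMap_intValue {g : K[X]} (hg : g ∈ nonzeroInt R K) (c : R) :
    algebraMap R K (intValue g c) = g.eval (algebraMap R K c) :=
  Function.invFun_eq (hg.1 c)

theorem intValue_ne_zero {g : K[X]} (hg : g ∈ nonzeroInt R K) {c : R}
    (h : g.eval (algebraMap R K c) ≠ 0) : intValue g c ≠ 0 := by
  intro h0
  rw [← algebraMap_intValue hg, h0, map_zero] at h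
  exact h rfl

variable [IsFractionRing R K]

theorem intValue_eq {g : K[X]} {c r : R} (h : algebraMap R K r = g.eval (algebraMap R K c)) :
    intValue g c = r := by
  rw [intValue, ← h]
  exact Function.leftInverse_invFun (IsFractionRing.injective R K) r

theorem intValue_mul {g h : K[X]} (hg : g ∈ nonzeroInt R K) (hh : h ∈ nonzeroInt R K) (c : R) :
    intValue (g * h) c = intValue g c * intValue h c :=
  intValue_eq (by rw [map_mul, algebraMap_intValue hg, algebraMap_intValue hh, eval_mul])

theorem map_mem_nonzeroInt {p : R[X]} (hp : p ≠ 0) : p.map (algebraMap R K) ∈ nonzeroInt R K :=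
  (ofPoly K p hp).2

theorem intValue_map (p : R[X]) (c : R) : intValue (p.map (algebraMap R K)) c = p.eval c :=
  intValue_eq (by rw [eval_map_apply])

theorem minVal_eq {g : K[X]} (hg : g ∈ nonzeroInt R K) (p : R) :
    minVal g p = (sInf (Set.range fun c : R => emultiplicity p (intValue g c))).toNat := by
  unfold minVal
  congr 2
  ext n
  constructor
  · rintro ⟨c, r, hr, rfl⟩
    exact ⟨c, congrArg (emultiplicity p) (intValue_eq hr)⟩
  · rintro ⟨c, rfl⟩
    exact ⟨c, _, algebraMap_intValue hg c, rfl⟩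

variable [IsDomain R]

theorem exists_eval_add_mul_ne_zero [Infinite R] {q : K[X]} (hq : q ≠ 0) (c : R) {m : R}
    (hm : m ≠ 0) : ∃ y : R, q.eval (algebraMap R K (c + m * y)) ≠ 0 := by
  by_contra! h
  refine hq (eq_zero_of_infinite_isRoot q ?_)
  have hinj : Function.Injective fun y : R => algebraMap R K (c + m * y) := fun x y hxy =>
    mul_left_cancel₀ hm (add_left_cancel (IsFractionRing.injective R K hxy))
  refine (Set.infinite_range_of_injective hinj).mono ?_
  rintro _ ⟨y, rfl⟩
  exact h y

variable [UniqueFactorizationMonoid R]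

/-- An infinite infimum would be turned into `0` by `toNat`; a point where `g` does not vanish
excludes this. -/
theorem coe_minVal {g : K[X]} (hg : g ∈ nonzeroInt R K) {p : R} (hp : Prime p) :
    (minVal g p : ℕ∞) = sInf (Set.range fun c : R => emultiplicity p (intValue g c)) := by
  rw [minVal_eq hg, ENat.natCast_toNat]
  have := infinite_of_prime hp
  obtain ⟨y, hy⟩ := exists_eval_add_mul_ne_zero hg.2 0 (one_ne_zero (α := R))
  have hfin := FiniteMultiplicity.of_prime_left hp (intValue_ne_zero hg hy)
  exact ne_top_of_le_ne_top (finiteMultiplicity_iff_emultiplicity_ne_top.1 hfin)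
    (sInf_le ⟨_, rfl⟩)

theorem minVal_le {g : K[X]} (hg : g ∈ nonzeroInt R K) {p : R} (hp : Prime p) (c : R) :
    (minVal g p : ℕ∞) ≤ emultiplicity p (intValue g c) := by
  rw [coe_minVal hg hp]
  exact sInf_le ⟨c, rfl⟩

theorem le_minVal_iff {g : K[X]} (hg : g ∈ nonzeroInt R K) {p : R} (hp : Prime p) {n : ℕ} :
    n ≤ minVal g p ↔ ∀ c : R, p ^ n ∣ intValue g c := by
  rw [← Nat.cast_le (α := ℕ∞), coe_minVal hg hp, le_sInf_iff, Set.forall_mem_range]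
  simp_rw [pow_dvd_iff_le_emultiplicity]

/-- The minimal valuation is attained off the zeros of any prescribed nonzero polynomial. -/
theorem exists_emultiplicity_eq_minVal {g q : K[X]} (hg : g ∈ nonzeroInt R K) (hq : q ≠ 0) {p : R}
    (hp : Prime p) : ∃ c : R, q.eval (algebraMap R K c) ≠ 0 ∧
      emultiplicity p (intValue g c) = minVal g p := by
  have := infinite_of_prime hp
  obtain ⟨c, hc⟩ := csInf_mem (Set.range_nonempty fun c : R => emultiplicity p (intValue g c))
  rw [← coe_minVal hg hp] at hc
  obtain ⟨b, hb, hbg⟩ := IsLocalization.integerNormalization_spec (nonZeroDivisors R) g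
  have hb0 : b ≠ 0 := nonZeroDivisors.ne_zero hb
  set G := IsLocalization.integerNormalization (nonZeroDivisors R) g
  have hG : ∀ x, G.eval x = b * intValue g x := fun x => by
    apply IsFractionRing.injective R K
    rw [map_mul, algebraMap_intValue hg, ← eval_map_apply, hbg, eval_smul, Algebra.smul_def]
  set n := minVal g p
  -- Moving `c` by a multiple of `b * p ^ (n + 1)`, with `b` a denominator of `g`, changes the value
  -- of `g` by a multiple of `p ^ (n + 1)`, so the valuation `n` survives.
  obtain ⟨y, hy⟩ := exists_eval_add_mul_ne_zero hq c
    (mul_ne_zero hb0 (pow_ne_zero (n + 1) hp.ne_zero))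
  refine ⟨_, hy, le_antisymm ?_ (minVal_le hg hp _)⟩
  set c' := c + b * p ^ (n + 1) * y
  have hdvd : b * p ^ (n + 1) ∣ b * (intValue g c' - intValue g c) := by
    rw [mul_sub, ← hG, ← hG]
    refine Dvd.dvd.trans ⟨y, ?_⟩ (sub_dvd_eval_sub c' c G)
    simp [c']
  replace hdvd := (mul_dvd_mul_iff_left hb0).1 hdvd
  refine Order.le_of_lt_add_one (not_le.1 fun hle => ?_)
  have h1 : p ^ (n + 1) ∣ intValue g c := by
    rw [← dvd_sub_right (pow_dvd_iff_le_emultiplicity.2 (by exact_mod_cast hle))]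
    exact hdvd
  have h2 : ((n + 1 : ℕ) : ℕ∞) ≤ n := (pow_dvd_iff_le_emultiplicity.1 h1).trans hc.le
  exact absurd (Nat.cast_le.1 h2) (by omega)

end Values

/-! ### Products of prime powers over a system of representatives -/

section RepSystem

variable {R : Type*} [CommRing R] {Q : Set R}

theorem finprod_pow_eq_prod {k : R → ℕ} (hk : {p | p ∈ Q ∧ k p ≠ 0}.Finite) :
    ∏ᶠ q ∈ Q, q ^ k q = ∏ q ∈ hk.toFinset, q ^ k q := by
  refine finprod_mem_eq_prod_of_subset _ ?_ ?_
  · rintro q ⟨hq, hq'⟩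
    rw [Set.Finite.coe_toFinset]
    refine ⟨hq, fun h0 => hq' ?_⟩
    simp [h0]
  · rw [Set.Finite.coe_toFinset]
    exact fun q hq => hq.1

variable [UniqueFactorizationMonoid R]

theorem IsRepSystem.prime (hQ : IsRepSystem Q {p : R | Irreducible p}) {p : R} (hp : p ∈ Q) :
    Prime p :=
  (hQ.1 hp : Irreducible p).prime

theorem IsRepSystem.eq_of_associated {H : Type*} [CommMonoid H] {F E : Set H}
    (h : IsRepSystem F E) {x y : H} (hx : x ∈ F) (hy : y ∈ F) (hxy : Associated x y) : x = y :=
  (h.2 x (h.1 hx)).unique ⟨hx, Associated.refl x⟩ ⟨hy, hxy⟩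

theorem IsRepSystem.finite_dvd (hQ : IsRepSystem Q {p : R | Irreducible p}) {a : R} (ha : a ≠ 0) :
    {p | p ∈ Q ∧ p ∣ a}.Finite := by
  classical
  have hfin : (⋃ q ∈ (UniqueFactorizationMonoid.factors a).toFinset,
      {p | p ∈ Q ∧ Associated p q}).Finite := by
    refine (Finset.finite_toSet _).biUnion fun q _ => Set.Subsingleton.finite ?_
    rintro x ⟨hx, hxq⟩ y ⟨hy, hyq⟩
    exact hQ.eq_of_associated hx hy (hxq.trans hyq.symm)
  refine hfin.subset ?_
  rintro p ⟨hp, hpa⟩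
  obtain ⟨q, hq, hpq⟩ := UniqueFactorizationMonoid.exists_mem_factors_of_dvd ha (hQ.1 hp) hpa
  exact Set.mem_biUnion (Multiset.mem_toFinset.2 hq) ⟨hp, hpq⟩

variable [IsDomain R]

theorem IsRepSystem.finprod_pow_ne_zero (hQ : IsRepSystem Q {p : R | Irreducible p}) (k : R → ℕ) :
    ∏ᶠ q ∈ Q, q ^ k q ≠ 0 :=
  finprod_mem_induction (· ≠ 0) one_ne_zero (fun _ _ => mul_ne_zero)
    fun _ hq => pow_ne_zero _ (hQ.prime hq).ne_zero

/-- Finiteness of the support matters: otherwise `∏ᶠ` defaults to `1`. -/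
theorem IsRepSystem.emultiplicity_finprod_pow (hQ : IsRepSystem Q {p : R | Irreducible p})
    {k : R → ℕ} (hk : {p | p ∈ Q ∧ k p ≠ 0}.Finite) {p : R} (hp : p ∈ Q) :
    emultiplicity p (∏ᶠ q ∈ Q, q ^ k q) = k p := by
  have hpp := hQ.prime hp
  rw [finprod_pow_eq_prod hk, Finset.emultiplicity_prod hpp, Finset.sum_eq_single p]
  · exact emultiplicity_pow_self_of_prime hpp _
  · intro q hq hqp
    have hqQ : q ∈ Q := (hk.mem_toFinset.1 hq).1
    rw [emultiplicity_pow hpp, emultiplicity_eq_zero.2, mul_zero]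
    intro hdvd
    exact hqp (hQ.eq_of_associated hp hqQ
      (hpp.irreducible.associated_of_dvd (hQ.prime hqQ).irreducible hdvd)).symm
  · intro h
    have : k p = 0 := by
      by_contra h0
      exact h (hk.mem_toFinset.2 ⟨hp, h0⟩)
    rw [this, pow_zero]
    exact emultiplicity_eq_zero.2 hpp.not_dvd_one

theorem IsRepSystem.dvd_of_emultiplicity_le (hQ : IsRepSystem Q {p : R | Irreducible p}) {a b : R}
    (ha : a ≠ 0) (h : ∀ p ∈ Q, emultiplicity p a ≤ emultiplicity p b) : a ∣ b := by
  refine (UniqueFactorizationMonoid.dvd_iff_emultiplicity_le ha).2 fun p hp => ?_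
  obtain ⟨q, ⟨hq, hpq⟩, -⟩ := hQ.2 p hp.irreducible
  rw [← emultiplicity_eq_of_associated_left hpq, ← emultiplicity_eq_of_associated_left hpq]
  exact h q hq

end RepSystem

/-! ### The monoid `[[f]]` and descent from `K[X]` to `R[X]` -/

section Monadic

variable {R K : Type*} [CommRing R] [Field K] [Algebra R K]

theorem mem_nonzeroInt_of_mem_monadic {F : nonzeroInt R K} {g : K[X]} (hg : g ∈ monadic F) :
    g ∈ nonzeroInt R K := by
  obtain ⟨x, -, rfl⟩ := hg
  exact x.2

theorem mem_monadic_iff {F : nonzeroInt R K} {g : K[X]} :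
    g ∈ monadic F ↔ g ∈ nonzeroInt R K ∧ ∃ h ∈ nonzeroInt R K, ∃ n : ℕ, g * h = (F : K[X]) ^ n := by
  constructor
  · rintro ⟨x, hx, rfl⟩
    obtain ⟨n, y, hy⟩ := mem_divisorClosure_singleton.1 hx
    exact ⟨x.2, y, y.2, n, (congrArg Subtype.val hy).symm⟩
  · rintro ⟨hg, h, hh, n, hn⟩
    exact ⟨⟨g, hg⟩, mem_divisorClosure_singleton.2 ⟨n, ⟨h, hh⟩, Subtype.ext hn.symm⟩, rfl⟩

theorem mem_monadic_of_mul_mem {F : nonzeroInt R K} {g h : K[X]} (hg : g ∈ nonzeroInt R K)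
    (hh : h ∈ nonzeroInt R K) (hgh : g * h ∈ monadic F) : g ∈ monadic F := by
  obtain ⟨-, k, hk, n, hn⟩ := mem_monadic_iff.1 hgh
  exact mem_monadic_iff.2 ⟨hg, h * k, mul_mem hh hk, n, by rw [← hn, mul_assoc]⟩

theorem exists_dvd_pow_of_mem_monadic {F : nonzeroInt R K} {g : K[X]} (hg : g ∈ monadic F) :
    ∃ n : ℕ, g ∣ (F : K[X]) ^ n := by
  obtain ⟨-, h, -, n, hn⟩ := mem_monadic_iff.1 hg
  exact ⟨n, h, hn.symm⟩

theorem self_mem_monadic (F : nonzeroInt R K) : (F : K[X]) ∈ monadic F :=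
  mem_monadic_iff.2 ⟨F.2, 1, one_mem _, 1, by rw [mul_one, pow_one]⟩

variable [IsFractionRing R K]

theorem C_mem_nonzeroInt {r : R} (hr : r ≠ 0) : C (algebraMap R K r) ∈ nonzeroInt R K := by
  have := map_mem_nonzeroInt (K := K) (C_ne_zero.2 hr)
  rwa [map_C] at this

/-- A constant that divides all values of an element of a monadic submonoid lies in it. -/
theorem C_mem_monadic {F : nonzeroInt R K} {g : K[X]} (hg : g ∈ monadic F) {r : R} (hr : r ≠ 0)
    (h : ∀ c : R, r ∣ intValue g c) : C (algebraMap R K r) ∈ monadic F := by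
  have hr' : algebraMap R K r ≠ 0 := by
    simpa using hr
  have hg' := mem_nonzeroInt_of_mem_monadic hg
  refine mem_monadic_of_mul_mem (h := C (algebraMap R K r)⁻¹ * g) (C_mem_nonzeroInt hr)
    ⟨fun c => ?_, mul_ne_zero (C_ne_zero.2 (inv_ne_zero hr')) hg'.2⟩ ?_
  · obtain ⟨s, hs⟩ := h c
    refine ⟨s, ?_⟩
    rw [eval_mul, eval_C, ← algebraMap_intValue hg', hs, map_mul, inv_mul_cancel_left₀ hr']
  · rwa [← mul_assoc, ← C_mul, mul_inv_cancel₀ hr', C_1, one_mul]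

theorem map_mem_monadic_of_dvd_pow {f : R[X]} (hf : f ≠ 0) [IsDomain R] {a : R[X]} {n : ℕ}
    (h : a ∣ f ^ n) : a.map (algebraMap R K) ∈ monadic (ofPoly K f hf) := by
  obtain ⟨b, hb⟩ := h
  have hab : a * b ≠ 0 := hb ▸ pow_ne_zero n hf
  refine mem_monadic_iff.2 ⟨map_mem_nonzeroInt (left_ne_zero_of_mul hab), b.map (algebraMap R K),
    map_mem_nonzeroInt (right_ne_zero_of_mul hab), n, ?_⟩
  rw [← Polynomial.map_mul, ← hb, Polynomial.map_pow]
  rfl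

variable [IsDomain R] [UniqueFactorizationMonoid R]

theorem exists_isPrimitive_associate {k : K[X]} (hk : k ≠ 0) : ∃ b c : R, b ≠ 0 ∧ c ≠ 0 ∧
    ∃ a : R[X], a.IsPrimitive ∧
      C (algebraMap R K b) * k = C (algebraMap R K c) * a.map (algebraMap R K) := by
  classical
  let _ := UniqueFactorizationMonoid.strongNormalizationMonoid (α := R)
  let _ := UniqueFactorizationMonoid.toNormalizedGCDMonoid R
  obtain ⟨b, hb, hbk⟩ := IsLocalization.integerNormalization_spec (nonZeroDivisors R) k
  have hb0 : b ≠ 0 := nonZeroDivisors.ne_zero hb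
  set G := IsLocalization.integerNormalization (nonZeroDivisors R) k
  have hbk' : C (algebraMap R K b) * k = G.map (algebraMap R K) := by
    rw [hbk, Algebra.smul_def]
    rfl
  have hG : G ≠ 0 := by
    intro h
    rw [h, Polynomial.map_zero] at hbk'
    exact mul_ne_zero (C_ne_zero.2 (by simpa using hb0)) hk hbk'
  refine ⟨b, G.content, hb0, mt content_eq_zero_iff.1 hG, G.primPart, G.isPrimitive_primPart, ?_⟩
  rw [hbk', ← map_C, ← Polynomial.map_mul, ← eq_C_content_mul_primPart]

/-- A divisor of a power of `f` over the quotient field is, up to constants, a divisor of that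
power over the base ring. -/
theorem exists_dvd_pow_associate {f : R[X]} (hf : f ≠ 0) {k : K[X]} {n : ℕ}
    (hk : k ∣ (f.map (algebraMap R K)) ^ n) : ∃ b c : R, b ≠ 0 ∧ c ≠ 0 ∧
    ∃ a : R[X], a ∣ f ^ n ∧
      C (algebraMap R K b) * k = C (algebraMap R K c) * a.map (algebraMap R K) := by
  have hk0 : k ≠ 0 := ne_zero_of_dvd_ne_zero (pow_ne_zero n
    ((Polynomial.map_ne_zero_iff (IsFractionRing.injective R K)).2 hf)) hk
  obtain ⟨b, c, hb, hc, a, ha, h⟩ := exists_isPrimitive_associate (R := R) hk0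
  -- Gauss's lemma: divisibility by a primitive polynomial over `K` descends to `R`.
  refine ⟨b, c, hb, hc, a, ha.dvd_of_fraction_map_dvd_fraction_map (K := K) ?_, h⟩
  have hbu : IsUnit (C (algebraMap R K b)) := isUnit_C.2 (by simpa using hb)
  have hcu : IsUnit (C (algebraMap R K c)) := isUnit_C.2 (by simpa using hc)
  rw [Polynomial.map_pow, ← hcu.mul_left_dvd, ← h, hbu.mul_left_dvd]
  exact hk

end Monadic

/-! ### Finiteness of `e_f(g)` and clearing of denominators -/

section FixedDivisor

variable {R K : Type*} [CommRing R] [IsDomain R] [UniqueFactorizationMonoid R] [Field K]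
  [Algebra R K] {Q : Set R}

theorem eElem_ne_zero (hQ : IsRepSystem Q {p : R | Irreducible p}) (F : nonzeroInt R K) (g : K[X]) :
    eElem Q F g ≠ 0 :=
  hQ.finprod_pow_ne_zero _

variable [IsFractionRing R K]

/-- Up to a unit, `a` is a product of factors of `f`, and valuations add up. -/
theorem emultiplicity_eval_le_of_dvd_pow {f : R[X]} (hf : f ≠ 0) {p c c' : R} (hp : Prime p)
    (hw : ∀ t ∈ UniqueFactorizationMonoid.factors f,
      emultiplicity p (t.eval c) ≤ emultiplicity p (t.eval c')) {n : ℕ} {a : R[X]}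
    (ha : a ∣ f ^ n) : emultiplicity p (a.eval c) ≤ emultiplicity p (a.eval c') := by
  have key : ∀ {s t : R[X]}, Associated s t → ∀ x : R,
      emultiplicity p (s.eval x) = emultiplicity p (t.eval x) := fun h x =>
    emultiplicity_eq_of_associated_right (h.map (evalRingHom x))
  induction a using UniqueFactorizationMonoid.induction_on_prime with
  | h₁ => simp
  | h₂ u hu =>
    rw [key (associated_one_iff_isUnit.2 hu), key (associated_one_iff_isUnit.2 hu)]
    simp
  | h₃ a t _ ht ih =>
    obtain ⟨q, hq, htq⟩ := UniqueFactorizationMonoid.exists_mem_factors_of_dvd hf ht.irreducible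
      (ht.dvd_of_dvd_pow ((dvd_mul_right t a).trans ha))
    rw [eval_mul, eval_mul, emultiplicity_mul hp, emultiplicity_mul hp, key htq, key htq]
    exact add_le_add (hw q hq) (ih ((dvd_mul_left a t).trans ha))

theorem emultiplicity_intValue_le {f : R[X]} (hf : f ≠ 0) {p c c' : R} (hp : Prime p)
    (hw : ∀ t ∈ UniqueFactorizationMonoid.factors f,
      emultiplicity p (t.eval c) ≤ emultiplicity p (t.eval c')) {h : K[X]}
    (hh : h ∈ monadic (ofPoly K f hf)) :
    emultiplicity p (intValue h c) ≤ emultiplicity p (intValue h c') := by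
  obtain ⟨n, hn⟩ := exists_dvd_pow_of_mem_monadic hh
  obtain ⟨b, r, hb, hr, a, ha, hba⟩ := exists_dvd_pow_associate hf hn
  have hval : ∀ x : R, b * intValue h x = r * a.eval x := fun x => by
    apply IsFractionRing.injective R K
    have := congrArg (eval (algebraMap R K x)) hba
    rwa [eval_mul, eval_mul, eval_C, eval_C, eval_map_apply,
      ← algebraMap_intValue (mem_nonzeroInt_of_mem_monadic hh), ← map_mul, ← map_mul] at this
  have hfin := finiteMultiplicity_iff_emultiplicity_ne_top.1 (FiniteMultiplicity.of_prime_left hp hb)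
  -- The constants `b` and `r` contribute the same amount at `c` and at `c'`.
  refine (ENat.add_le_add_iff_left hfin).1 ?_
  rw [← emultiplicity_mul hp, ← emultiplicity_mul hp, hval, hval, emultiplicity_mul hp,
    emultiplicity_mul hp]
  gcongr
  exact emultiplicity_eval_le_of_dvd_pow hf hp hw ha

/-- Dickson's lemma: the minimal elements of `w '' A` form an antichain, which is finite in a
well-quasi-order. -/
theorem exists_finite_forall_exists_le {α β : Type*} [PartialOrder β] [WellQuasiOrderedLE β]
    (w : α → β) (A : Set α) : ∃ T : Finset α, ↑T ⊆ A ∧ ∀ x ∈ A, ∃ y ∈ T, w y ≤ w x := by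
  classical
  rcases isEmpty_or_nonempty α with _ | _
  · exact ⟨∅, by simp, fun x => isEmptyElim x⟩
  have hfin : {b | Minimal (· ∈ w '' A) b}.Finite :=
    WellQuasiOrderedLE.finite_of_isAntichain (setOfPred_minimal_antichain _)
  have hex : ∀ b ∈ w '' A, ∃ x ∈ A, w x = b := fun b hb => hb
  choose! v hvA hv using hex
  refine ⟨hfin.toFinset.image v, ?_, fun x hx => ?_⟩
  · intro y hy
    rw [Finset.mem_coe, Finset.mem_image] at hy
    obtain ⟨b, hb, rfl⟩ := hy
    exact hvA b (hfin.mem_toFinset.1 hb).prop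
  · obtain ⟨b, hbx, hb⟩ := exists_minimal_le_of_wellFoundedLT (· ∈ w '' A) (w x) ⟨x, hx, rfl⟩
    exact ⟨v b, Finset.mem_image_of_mem v (hfin.mem_toFinset.2 hb), (hv b hb.prop).trans_le hbx⟩

/-- The bound `M` is independent of `h`: the minimum for `h` is attained at some `c` with `g(c) ≠
0`, and replacing `c` by a point of the finite set `T` below it does not increase the valuation of
`h`. -/
theorem exists_minVal_mul_le {f : R[X]} (hf : f ≠ 0) {p : R} (hp : Prime p) {g : K[X]}
    (hg : g ∈ monadic (ofPoly K f hf)) :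
    ∃ M : ℕ, ∀ h ∈ monadic (ofPoly K f hf), minVal (g * h) p ≤ M + minVal h p := by
  classical
  have hg' := mem_nonzeroInt_of_mem_monadic hg
  let w : R → {t // t ∈ (UniqueFactorizationMonoid.factors f).toFinset} → ℕ∞ :=
    fun c t => emultiplicity p (t.1.eval c)
  obtain ⟨T, hTA, hT⟩ := exists_finite_forall_exists_le w
    {c : R | g.eval (algebraMap R K c) ≠ 0}
  refine ⟨T.sup fun c => multiplicity p (intValue g c), fun h hh => ?_⟩
  have hh' := mem_nonzeroInt_of_mem_monadic hh
  obtain ⟨c, hcA, hc⟩ := exists_emultiplicity_eq_minVal hh' hg'.2 hp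
  obtain ⟨c', hc'T, hle⟩ := hT c hcA
  rw [← Nat.cast_le (α := ℕ∞), Nat.cast_add, ← hc]
  refine (minVal_le (mul_mem hg' hh') hp c').trans ?_
  rw [intValue_mul hg' hh', emultiplicity_mul hp]
  refine add_le_add ?_ (emultiplicity_intValue_le hf hp
    (fun t ht => hle ⟨t, Multiset.mem_toFinset.2 ht⟩) hh)
  rw [(FiniteMultiplicity.of_prime_left hp
    (intValue_ne_zero hg' (hTA hc'T))).emultiplicity_eq_multiplicity, Nat.cast_le]
  exact Finset.le_sup (f := fun c => multiplicity p (intValue g c)) hc'T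

theorem finite_minVal_ne_zero (hQ : IsRepSystem Q {p : R | Irreducible p}) {g : K[X]}
    (hg : g ∈ nonzeroInt R K) : {p | p ∈ Q ∧ minVal g p ≠ 0}.Finite := by
  rcases Q.eq_empty_or_nonempty with rfl | ⟨q, hq⟩
  · simp
  have := infinite_of_prime (hQ.prime hq)
  obtain ⟨y, hy⟩ := exists_eval_add_mul_ne_zero hg.2 0 (one_ne_zero (α := R))
  refine (hQ.finite_dvd (intValue_ne_zero hg hy)).subset ?_
  rintro p ⟨hp, hp0⟩
  have := (le_minVal_iff hg (hQ.prime hp) (n := 1)).1 (Nat.one_le_iff_ne_zero.2 hp0)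
  exact ⟨hp, pow_one p ▸ this _⟩

theorem emultiplicity_fixedDivisor (hQ : IsRepSystem Q {p : R | Irreducible p}) {g : K[X]}
    (hg : g ∈ nonzeroInt R K) {p : R} (hp : p ∈ Q) :
    emultiplicity p (fixedDivisor Q g) = minVal g p :=
  hQ.emultiplicity_finprod_pow (finite_minVal_ne_zero hQ hg) hp

theorem minVal_le_minVal_mul {g h : K[X]} (hg : g ∈ nonzeroInt R K) (hh : h ∈ nonzeroInt R K)
    {p : R} (hp : Prime p) : minVal h p ≤ minVal (g * h) p := by
  refine (le_minVal_iff (mul_mem hg hh) hp).2 fun c => ?_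
  rw [intValue_mul hg hh]
  exact ((le_minVal_iff hh hp).1 le_rfl c).mul_left _

theorem fixedDivisor_dvd_fixedDivisor_mul (hQ : IsRepSystem Q {p : R | Irreducible p}) {g h : K[X]}
    (hg : g ∈ nonzeroInt R K) (hh : h ∈ nonzeroInt R K) :
    fixedDivisor Q h ∣ fixedDivisor Q (g * h) := by
  refine hQ.dvd_of_emultiplicity_le (hQ.finprod_pow_ne_zero _) fun p hp => ?_
  rw [emultiplicity_fixedDivisor hQ hh hp, emultiplicity_fixedDivisor hQ (mul_mem hg hh) hp,
    Nat.cast_le]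
  exact minVal_le_minVal_mul hg hh (hQ.prime hp)

theorem maxVal_eq (hQ : IsRepSystem Q {p : R | Irreducible p}) (F : nonzeroInt R K) {g : K[X]}
    (hg : g ∈ nonzeroInt R K) {p : R} (hp : p ∈ Q) :
    maxVal Q F g p = sSup {n : ℕ | ∃ h ∈ monadic F, n + minVal h p = minVal (g * h) p} := by
  unfold maxVal
  congr 1
  ext n
  refine exists_congr fun h => and_congr_right fun hh => ?_
  have hh' := mem_nonzeroInt_of_mem_monadic hh
  have hpp := hQ.prime hp
  have hcalc : ∀ c : R, c * fixedDivisor Q h = fixedDivisor Q (g * h) →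
      emultiplicity p c + minVal h p = minVal (g * h) p := fun c hc => by
    rw [← emultiplicity_fixedDivisor hQ hh' hp, ← emultiplicity_mul hpp, hc,
      emultiplicity_fixedDivisor hQ (mul_mem hg hh') hp]
  constructor
  · rintro ⟨c, hc, hn⟩
    have := hcalc c hc
    rw [hn] at this
    exact_mod_cast this
  · intro hn
    obtain ⟨c, hc⟩ := fixedDivisor_dvd_fixedDivisor_mul hQ hg hh'
    have hc' := (mul_comm c _).trans hc.symm
    refine ⟨c, hc', ?_⟩
    have := hcalc c hc'
    rw [← hn, Nat.cast_add] at this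
    exact (WithTop.add_right_inj (ENat.natCast_ne_top _)).1 this

variable {f : R[X]} {hf : f ≠ 0}

/-- Boundedness is essential here, as `sSup` of an unbounded set of naturals is `0`. -/
theorem minVal_mul_le (hQ : IsRepSystem Q {p : R | Irreducible p}) {g h : K[X]}
    (hg : g ∈ monadic (ofPoly K f hf)) (hh : h ∈ monadic (ofPoly K f hf)) {p : R} (hp : p ∈ Q) :
    minVal (g * h) p ≤ maxVal Q (ofPoly K f hf) g p + minVal h p := by
  have hg' := mem_nonzeroInt_of_mem_monadic hg
  have hh' := mem_nonzeroInt_of_mem_monadic hh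
  have hle := minVal_le_minVal_mul hg' hh' (hQ.prime hp)
  obtain ⟨M, hM⟩ := exists_minVal_mul_le hf (hQ.prime hp) hg
  have hmem : minVal (g * h) p - minVal h p ≤ maxVal Q (ofPoly K f hf) g p := by
    rw [maxVal_eq hQ _ hg' hp]
    refine le_csSup ⟨M, ?_⟩ ⟨h, hh, by omega⟩
    rintro n ⟨k, hk, hn⟩
    have := hM k hk
    omega
  omega

/-- A representative prime that occurs in `e_f(g)` divides all values of some element of the
monadic submonoid. -/
theorem exists_forall_dvd_of_maxVal_ne_zero (hQ : IsRepSystem Q {p : R | Irreducible p})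
    {F : nonzeroInt R K} {g : K[X]} (hg : g ∈ monadic F) {p : R} (hp : p ∈ Q)
    (h0 : maxVal Q F g p ≠ 0) : ∃ k ∈ monadic F, ∀ c : R, p ∣ intValue k c := by
  by_contra! hcon
  refine h0 ?_
  rw [maxVal_eq hQ F (mem_nonzeroInt_of_mem_monadic hg) hp, ← Nat.le_zero]
  refine csSup_le' ?_
  rintro n ⟨h, hh, hn⟩
  by_contra hn0
  obtain ⟨c, hc⟩ := hcon (g * h) (mul_mem hg hh)
  refine hc (pow_one p ▸ ((le_minVal_iff (n := 1) (mem_nonzeroInt_of_mem_monadic (mul_mem hg hh))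
    (hQ.prime hp)).1 ?_ c))
  omega

/-- Each prime occurring in `e_f(g)` divides all values of some element of `[[f]]`, so it lies in
`[[f]]` itself. -/
theorem C_eElem_mem_monadic (hQ : IsRepSystem Q {p : R | Irreducible p})
    {F : nonzeroInt R K} {g : K[X]} (hg : g ∈ monadic F) :
    C (algebraMap R K (eElem Q F g)) ∈ monadic F := by
  refine finprod_mem_induction (fun r => C (algebraMap R K r) ∈ monadic F) ?_ ?_ ?_
  · simp
  · intro x y hx hy
    rw [map_mul, C_mul]
    exact mul_mem hx hy
  · intro p hp
    rw [map_pow, C_pow]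
    by_cases h0 : maxVal Q F g p = 0
    · simp [h0]
    · obtain ⟨k, hk, hk'⟩ := exists_forall_dvd_of_maxVal_ne_zero hQ hg hp h0
      exact pow_mem (C_mem_monadic hk (hQ.prime hp).ne_zero hk') _

/-- Such a prime divides all values of a divisor of a power of `F`, hence all values of `F`. -/
theorem finite_maxVal_ne_zero (hQ : IsRepSystem Q {p : R | Irreducible p}) {F : nonzeroInt R K}
    {g : K[X]} (hg : g ∈ monadic F) : {p | p ∈ Q ∧ maxVal Q F g p ≠ 0}.Finite := by
  refine (finite_minVal_ne_zero hQ F.2).subset ?_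
  rintro p ⟨hp, h0⟩
  have hpp := hQ.prime hp
  obtain ⟨k, hk, hdvd⟩ := exists_forall_dvd_of_maxVal_ne_zero hQ hg hp h0
  obtain ⟨hk', h, hh, n, hn⟩ := mem_monadic_iff.1 hk
  refine ⟨hp, Nat.one_le_iff_ne_zero.1 ((le_minVal_iff F.2 hpp).2 fun c => ?_)⟩
  rw [pow_one]
  refine hpp.dvd_of_dvd_pow (n := n) ?_
  have : intValue F.1 c ^ n = intValue k c * intValue h c := by
    rw [← intValue_mul hk' hh, hn]
    refine (intValue_eq ?_).symm
    rw [map_pow, algebraMap_intValue F.2, eval_pow]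
  rw [this]
  exact (hdvd c).mul_right _

theorem emultiplicity_eElem (hQ : IsRepSystem Q {p : R | Irreducible p}) {F : nonzeroInt R K}
    {g : K[X]} (hg : g ∈ monadic F) {p : R} (hp : p ∈ Q) :
    emultiplicity p (eElem Q F g) = maxVal Q F g p :=
  hQ.emultiplicity_finprod_pow (finite_maxVal_ne_zero hQ hg) hp

/-- Multiplication by `e_f(g)` clears the denominators of cofactors of `g` in `[[f]]`. -/
theorem C_eElem_mul_mem_monadic (hQ : IsRepSystem Q {p : R | Irreducible p}) {g k : K[X]}
    (hg : g ∈ monadic (ofPoly K f hf)) (hgk : g * k ∈ monadic (ofPoly K f hf)) :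
    C (algebraMap R K (eElem Q (ofPoly K f hf) g)) * k ∈ monadic (ofPoly K f hf) := by
  set F := ofPoly K f hf with hF
  set e := eElem Q F g with he
  have hg' := mem_nonzeroInt_of_mem_monadic hg
  have hz' := mem_nonzeroInt_of_mem_monadic hgk
  have he0 : e ≠ 0 := eElem_ne_zero hQ F g
  obtain ⟨n, hn⟩ := exists_dvd_pow_of_mem_monadic hgk
  -- The cofactor `k` need not be integer-valued; up to the constants `b`, `r` it is a polynomial
  -- `a` in `[[f]]`, to which the bound defining `e` applies.
  obtain ⟨b, r, hb, hr, a, ha, hba⟩ := exists_dvd_pow_associate hf ((dvd_mul_left k g).trans hn)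
  have haF : a.map (algebraMap R K) ∈ monadic F := map_mem_monadic_of_dvd_pow hf ha
  have ha' := mem_nonzeroInt_of_mem_monadic haF
  have hb' : algebraMap R K b ≠ 0 := by simpa using hb
  have hdvd : ∀ x : R, b ∣ r * e * a.eval x := fun x => by
    refine hQ.dvd_of_emultiplicity_le hb fun p hp => ?_
    have hpp := hQ.prime hp
    -- Only at a minimizing point of `g * a` is integrality of `g * k` used; the definition of `e`
    -- transfers the bound to every `x`.
    obtain ⟨c, -, hc⟩ := exists_emultiplicity_eq_minVal (mul_mem hg' ha') one_ne_zero hpp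
    have hval : b * intValue (g * k) c = r * intValue (g * a.map (algebraMap R K)) c := by
      apply IsFractionRing.injective R K
      have := congrArg (eval (algebraMap R K c)) hba
      simp only [eval_mul, eval_C] at this
      rw [map_mul, map_mul, algebraMap_intValue hz', algebraMap_intValue (mul_mem hg' ha'),
        eval_mul, eval_mul, mul_left_comm, this, mul_left_comm]
    calc emultiplicity p b ≤ emultiplicity p (r * intValue (g * a.map (algebraMap R K)) c) :=
          emultiplicity_le_emultiplicity_of_dvd_right ⟨_, hval.symm⟩
      _ = emultiplicity p r + minVal (g * a.map (algebraMap R K)) p := by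
          rw [emultiplicity_mul hpp, hc]
      _ ≤ emultiplicity p r + (maxVal Q F g p + minVal (a.map (algebraMap R K)) p) := by
          gcongr
          exact_mod_cast minVal_mul_le hQ hg haF hp
      _ ≤ emultiplicity p r + (emultiplicity p e + emultiplicity p (a.eval x)) := by
          rw [emultiplicity_eElem hQ hg hp, ← intValue_map (K := K) a x]
          gcongr
          exact minVal_le ha' hpp x
      _ = emultiplicity p (r * e * a.eval x) := by
          rw [emultiplicity_mul hpp, emultiplicity_mul hpp, add_assoc]
  have hk0 : k ≠ 0 := right_ne_zero_of_mul hz'.2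
  have hek : C (algebraMap R K e) * k ∈ nonzeroInt R K := by
    refine ⟨fun x => ?_, mul_ne_zero (C_ne_zero.2 (by simpa using he0)) hk0⟩
    obtain ⟨s, hs⟩ := hdvd x
    refine ⟨s, mul_left_cancel₀ hb' ?_⟩
    have := congrArg (eval (algebraMap R K x)) hba
    rw [eval_mul, eval_mul, eval_C, eval_C, eval_map_apply] at this
    rw [← map_mul, ← hs, eval_mul, eval_C, mul_left_comm, this, map_mul, map_mul]
    ring
  refine mem_monadic_of_mul_mem hek hg' ?_
  rw [mul_assoc, mul_comm k g]
  exact mul_mem (C_eElem_mem_monadic hQ hg) hgk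

end FixedDivisor

/-! ### The ideals `gK[X] ∩ [[f]]` and the prime ideals of `[[f]]` -/

section Contraction

variable {R K : Type*} [CommRing R] [Field K] [Algebra R K]

theorem mem_contraction {F : nonzeroInt R K} {g : K[X]} {z : monadic F} :
    z ∈ contraction F g ↔ g ∣ (z : K[X]) :=
  Ideal.mem_span_singleton

theorem isPrimeSIdeal_contraction (F : nonzeroInt R K) {g : K[X]} (hg : Irreducible g) :
    IsPrimeSIdeal (contraction F g) := by
  refine ⟨Set.Subset.antisymm ?_ ?_, fun h => ?_, fun x y hxy => ?_⟩
  · rintro _ ⟨x, hx, y, -, rfl⟩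
    exact mem_contraction.2 ((mem_contraction.1 hx).mul_right (y : K[X]))
  · intro x hx
    exact ⟨x, hx, 1, Set.mem_univ _, mul_one x⟩
  · have h1 : (1 : monadic F) ∈ contraction F g := h ▸ Set.mem_univ _
    exact hg.not_dvd_one (mem_contraction.1 h1)
  · exact (hg.prime.dvd_or_dvd (mem_contraction.1 hxy)).imp mem_contraction.2 mem_contraction.2

theorem ne_C_of_mem_contraction {F : nonzeroInt R K} {g : K[X]} (hg : Irreducible g) {z : monadic F}
    (hz : z ∈ contraction F g) (r : R) : (z : K[X]) ≠ C (algebraMap R K r) := by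
  intro h
  have hz0 : (z : K[X]) ≠ 0 := (mem_nonzeroInt_of_mem_monadic z.2).2
  refine hg.not_isUnit (isUnit_of_dvd_unit (mem_contraction.1 hz) ?_)
  rw [h] at hz0 ⊢
  exact isUnit_C.2 (isUnit_iff_ne_zero.2 (C_ne_zero.1 hz0))

theorem contraction_eq_of_associated (F : nonzeroInt R K) {g h : K[X]} (hgh : Associated g h) :
    contraction F g = contraction F h :=
  Set.ext fun _ => mem_contraction.trans (hgh.dvd_iff_dvd_left.trans mem_contraction.symm)

theorem _root_.Irreducible.isPrimitive_of_ne_C [IsDomain R] {t : R[X]} (ht : Irreducible t)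
    (hC : ∀ r : R, t ≠ C r) : t.IsPrimitive :=
  ht.isPrimitive fun h => hC _ (eq_C_of_natDegree_eq_zero h)

variable [IsFractionRing R K] [IsDomain R] [UniqueFactorizationMonoid R] {Q : Set R} {f : R[X]}
  {hf : f ≠ 0}

theorem exists_eElem_mul_eq (hQ : IsRepSystem Q {p : R | Irreducible p}) {g : K[X]}
    (hg : g ∈ monadic (ofPoly K f hf)) {z : K[X]} (hz : z ∈ monadic (ofPoly K f hf))
    (hgz : g ∣ z) : ∃ h ∈ monadic (ofPoly K f hf),
      C (algebraMap R K (eElem Q (ofPoly K f hf) g)) * z = g * h := by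
  obtain ⟨k, rfl⟩ := hgz
  exact ⟨_, C_eElem_mul_mem_monadic hQ hg hz, mul_left_comm _ _ _⟩

theorem isVIdeal_contraction (hQ : IsRepSystem Q {p : R | Irreducible p}) {g : K[X]}
    (hg : g ∈ monadic (ofPoly K f hf)) : IsVIdeal (contraction (ofPoly K f hf) g) := by
  let F := ofPoly K f hf
  let e : monadic F := ⟨_, C_eElem_mem_monadic hQ hg⟩
  let γ : monadic F := ⟨g, hg⟩
  let ι := Algebra.GrothendieckGroup.of (M := monadic F)
  -- Cancellativity makes the map into the quotient group injective.
  have hcancel : IsCancelMul (monadic F) :=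
    { mul_left_cancel := fun a b c h => Subtype.ext
        (mul_left_cancel₀ (mem_nonzeroInt_of_mem_monadic a.2).2 (congrArg Subtype.val h))
      mul_right_cancel := fun a b c h => Subtype.ext
        (mul_right_cancel₀ (mem_nonzeroInt_of_mem_monadic a.2).2 (congrArg Subtype.val h)) }
  refine Set.Subset.antisymm (fun y hy => ?_) ?_
  · have h1 : (1 : Algebra.GrothendieckGroup (monadic F)) ∈ fracInv (ι '' contraction F g) := by
      rintro _ ⟨z, -, rfl⟩
      exact ⟨z, (one_mul _).symm⟩
    have h2 : ι e * (ι γ)⁻¹ ∈ fracInv (ι '' contraction F g) := by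
      rintro _ ⟨z, hz, rfl⟩
      obtain ⟨h, hh, heq⟩ := exists_eElem_mul_eq hQ hg z.2 (mem_contraction.1 hz)
      refine ⟨⟨h, hh⟩, ?_⟩
      have heq' : e * z = γ * ⟨h, hh⟩ := Subtype.ext heq
      have := congrArg ι heq'
      rw [map_mul, map_mul] at this
      change ι ⟨h, hh⟩ = ι e * (ι γ)⁻¹ * ι z
      rw [mul_right_comm, this, mul_right_comm, mul_inv_cancel, one_mul]
    -- Testing against `1` puts `y` in `[[f]]`; testing against `e / g` makes `g` divide `e * y`,
    -- where `e` is a unit of `K[X]`.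
    obtain ⟨w, hw⟩ := hy 1 h1
    obtain ⟨h, hh⟩ := hy _ h2
    rw [mul_one] at hw
    refine ⟨w, mem_contraction.2 ?_, hw⟩
    rw [← hw] at hh
    have heq : γ * h = w * e := by
      refine Algebra.GrothendieckGroup.of_injective ?_
      rw [map_mul, map_mul, hh]
      change ι γ * (ι w * (ι e * (ι γ)⁻¹)) = ι w * ι e
      rw [← mul_assoc (ι w), mul_comm (ι γ), inv_mul_cancel_right]
    have heu : IsUnit (C (algebraMap R K (eElem Q F g))) :=
      isUnit_C.2 (by simpa using eElem_ne_zero hQ F g)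
    rw [← heu.dvd_mul_right]
    exact ⟨h, (congrArg Subtype.val heq).symm⟩
  · rintro _ ⟨z, hz, rfl⟩ x hx
    rw [mul_comm]
    exact hx _ ⟨z, hz, rfl⟩

/-- A nonempty prime ideal of `[[f]]` contains an irreducible factor of `f`. -/
theorem IsPrimeSIdeal.exists_irreducible_dvd_mem {P : Set (monadic (ofPoly K f hf))}
    (hP : IsPrimeSIdeal P) (hne : P.Nonempty) : ∃ t : R[X], Irreducible t ∧ t ∣ f ∧
      ∃ z ∈ P, (z : K[X]) = t.map (algebraMap R K) := by
  let F := ofPoly K f hf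
  -- Every element of `[[f]]` divides a power of `F` within `[[f]]`.
  have hFP : (⟨F, self_mem_monadic F⟩ : monadic F) ∈ P := by
    obtain ⟨z, hz⟩ := hne
    obtain ⟨hz', h, hh, n, hn⟩ := mem_monadic_iff.1 z.2
    have hhF : h ∈ monadic F := by
      refine mem_monadic_of_mul_mem hh hz' ?_
      rw [mul_comm, hn]
      exact pow_mem (self_mem_monadic F) n
    have hpow : (⟨F, self_mem_monadic F⟩ : monadic F) ^ n = z * ⟨h, hhF⟩ := Subtype.ext hn.symm
    exact hP.mem_of_pow_mem (hpow ▸ hP.mul_mem_right hz ⟨h, hhF⟩)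
  have key : ∀ a : R[X], a ∣ f → ∀ z ∈ P, (z : K[X]) = a.map (algebraMap R K) →
      ∃ t : R[X], Irreducible t ∧ t ∣ f ∧ ∃ z ∈ P, (z : K[X]) = t.map (algebraMap R K) := by
    intro a
    induction a using UniqueFactorizationMonoid.induction_on_prime with
    | h₁ => exact fun h => absurd (zero_dvd_iff.1 h) hf
    | h₂ u hu =>
      intro _ z hz hzu
      obtain ⟨v, hv⟩ := hu.exists_right_inv
      have hvF : v.map (algebraMap R K) ∈ monadic F :=
        map_mem_monadic_of_dvd_pow hf (n := 0) ⟨u, by rw [pow_zero, mul_comm, hv]⟩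
      have h1 : z * ⟨_, hvF⟩ = 1 := by
        refine Subtype.ext ?_
        change (z : K[X]) * v.map (algebraMap R K) = 1
        rw [hzu, ← Polynomial.map_mul, hv, Polynomial.map_one]
      exact absurd (h1 ▸ hP.mul_mem_right hz _) hP.one_notMem
    | h₃ a p _ hp ih =>
      intro hdvd z hz hzp
      have hpf := (dvd_mul_right p a).trans hdvd
      have haf := (dvd_mul_left a p).trans hdvd
      let x : monadic F := ⟨_, map_mem_monadic_of_dvd_pow hf (n := 1) ((pow_one f).symm ▸ hpf)⟩
      let y : monadic F := ⟨_, map_mem_monadic_of_dvd_pow hf (n := 1) ((pow_one f).symm ▸ haf)⟩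
      have hxy : z = x * y := Subtype.ext (hzp.trans (Polynomial.map_mul _))
      rcases hP.2.2 x y (hxy ▸ hz) with hx | hy
      · exact ⟨p, hp.irreducible, hpf, x, hx, rfl⟩
      · exact ih haf y hy rfl
  exact key f dvd_rfl _ hFP rfl

theorem IsPrimeSIdeal.contraction_subset (hQ : IsRepSystem Q {p : R | Irreducible p})
    {P : Set (monadic (ofPoly K f hf))} (hP : IsPrimeSIdeal P)
    (hC : ∀ z ∈ P, ∀ r : R, (z : K[X]) ≠ C (algebraMap R K r)) {x : monadic (ofPoly K f hf)}
    (hx : x ∈ P) : contraction (ofPoly K f hf) (x : K[X]) ⊆ P := by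
  intro z hz
  obtain ⟨h, hh, heq⟩ := exists_eElem_mul_eq hQ x.2 z.2 (mem_contraction.1 hz)
  have heq' : (⟨_, C_eElem_mem_monadic hQ x.2⟩ : monadic (ofPoly K f hf)) * z = x * ⟨h, hh⟩ :=
    Subtype.ext heq
  rcases hP.2.2 _ _ (heq' ▸ hP.mul_mem_right hx ⟨h, hh⟩) with he | hzP
  · exact absurd rfl (hC _ he _)
  · exact hzP

/-- A smaller nonempty prime still avoids constants, so it contains a nonconstant irreducible factor
of `f`, necessarily associated to `g` over `K`. -/
theorem contraction_mem_heightOnePrimes (hQ : IsRepSystem Q {p : R | Irreducible p}) {g : K[X]}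
    (hg : g ∈ monadic (ofPoly K f hf)) (hirr : Irreducible g) :
    contraction (ofPoly K f hf) g ∈ heightOnePrimes (monadic (ofPoly K f hf)) := by
  refine ⟨⟨isPrimeSIdeal_contraction _ hirr, ⟨g, hg⟩, mem_contraction.2 dvd_rfl⟩, ?_⟩
  rintro P ⟨hP, hne⟩ hPg
  have hC : ∀ z ∈ P, ∀ r : R, (z : K[X]) ≠ C (algebraMap R K r) := fun z hz =>
    ne_C_of_mem_contraction hirr (hPg hz)
  obtain ⟨t, ht, -, x, hx, hxt⟩ := hP.exists_irreducible_dvd_mem hne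
  have htC : ∀ r : R, t ≠ C r := fun r hr => hC x hx r (by rw [hxt, hr, map_C])
  have htirr : Irreducible (x : K[X]) := hxt ▸
    (ht.isPrimitive_of_ne_C htC).irreducible_iff_irreducible_map_fraction_map.1 ht
  rw [contraction_eq_of_associated _
    (hirr.associated_of_dvd htirr (mem_contraction.1 (hPg hx)))]
  exact hP.contraction_subset hQ hC hx

theorem contraction_mem_primesAvoidingConstants (hQ : IsRepSystem Q {p : R | Irreducible p})
    {g : K[X]} (hg : g ∈ monadic (ofPoly K f hf)) (hirr : Irreducible g) :
    contraction (ofPoly K f hf) g ∈ primesAvoidingConstants (ofPoly K f hf) :=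
  ⟨contraction_mem_heightOnePrimes hQ hg hirr, fun _ => ne_C_of_mem_contraction hirr⟩

theorem nonconstantAtoms_eq : nonconstantAtoms (ofPoly K f hf) =
    {t : R[X] | Irreducible t ∧ (∀ r : R, t ≠ C r) ∧ t ∣ f} := by
  ext t
  constructor
  · rintro ⟨hmem, ht, hC⟩
    refine ⟨ht, hC, ?_⟩
    obtain ⟨n, hn⟩ := exists_dvd_pow_of_mem_monadic hmem
    refine ht.prime.dvd_of_dvd_pow (n := n)
      ((ht.isPrimitive_of_ne_C hC).dvd_of_fraction_map_dvd_fraction_map (K := K) ?_)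
    rwa [Polynomial.map_pow]
  · rintro ⟨ht, hC, hdvd⟩
    exact ⟨map_mem_monadic_of_dvd_pow hf (n := 1) ((pow_one f).symm ▸ hdvd), ht, hC⟩

theorem irreducible_map_of_mem_nonconstantAtoms {F : nonzeroInt R K} {t : R[X]}
    (ht : t ∈ nonconstantAtoms F) : Irreducible (t.map (algebraMap R K)) :=
  (ht.2.1.isPrimitive_of_ne_C ht.2.2).irreducible_iff_irreducible_map_fraction_map.1 ht.2.1

theorem exists_nonconstantAtom_of_mem_primesAvoidingConstants
    (hQ : IsRepSystem Q {p : R | Irreducible p}) {P : Set (monadic (ofPoly K f hf))}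
    (hP : P ∈ primesAvoidingConstants (ofPoly K f hf)) :
    ∃ t ∈ nonconstantAtoms (ofPoly K f hf),
      P = contraction (ofPoly K f hf) (t.map (algebraMap R K)) := by
  obtain ⟨⟨⟨hprime, hne⟩, hmin⟩, hC⟩ := hP
  obtain ⟨t, ht, -, x, hx, hxt⟩ := hprime.exists_irreducible_dvd_mem hne
  have htT : t ∈ nonconstantAtoms (ofPoly K f hf) :=
    ⟨hxt ▸ x.2, ht, fun r hr => hC x hx r (by rw [hxt, hr, map_C])⟩
  have hsub := hprime.contraction_subset hQ hC hx
  rw [hxt] at hsub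
  exact ⟨t, htT, Set.Subset.antisymm (hmin ⟨isPrimeSIdeal_contraction _
    (irreducible_map_of_mem_nonconstantAtoms htT), x, mem_contraction.2 hxt.symm.dvd⟩ hsub) hsub⟩

theorem bijOn_contraction (hQ : IsRepSystem Q {p : R | Irreducible p}) {S : Set R[X]}
    (hS : IsRepSystem S (nonconstantAtoms (ofPoly K f hf))) :
    Set.BijOn (fun t => contraction (ofPoly K f hf) (t.map (algebraMap R K))) S
      (primesAvoidingConstants (ofPoly K f hf)) := by
  refine ⟨fun t ht => ?_, fun s hs t ht hst => ?_, fun P hP => ?_⟩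
  · exact contraction_mem_primesAvoidingConstants hQ (hS.1 ht).1
      (irreducible_map_of_mem_nonconstantAtoms (hS.1 ht))
  · have hsT := hS.1 hs
    have htT := hS.1 ht
    have hmem : (⟨_, htT.1⟩ : monadic (ofPoly K f hf)) ∈
        contraction (ofPoly K f hf) (s.map (algebraMap R K)) := by
      rw [show contraction _ (s.map (algebraMap R K)) = _ from hst]
      exact mem_contraction.2 dvd_rfl
    -- Since `s` is primitive, `s ∣ t` over `K` gives `s ∣ t` over `R`, and both are irreducible.
    exact hS.eq_of_associated hs ht (hsT.2.1.associated_of_dvd htT.2.1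
      ((hsT.2.1.isPrimitive_of_ne_C hsT.2.2).dvd_of_fraction_map_dvd_fraction_map (K := K)
        (mem_contraction.1 hmem)))
  · obtain ⟨t, ht, rfl⟩ := exists_nonconstantAtom_of_mem_primesAvoidingConstants hQ hP
    obtain ⟨s, ⟨hs, hts⟩, -⟩ := hS.2 t ht
    exact ⟨s, hs, contraction_eq_of_associated _ (hts.symm.map (mapRingHom (algebraMap R K)))⟩

theorem span_inter_monadic (hQ : IsRepSystem Q {p : R | Irreducible p}) {g : K[X]}
    (hg : g ∈ monadic (ofPoly K f hf)) :
    ((Ideal.span {g} : Ideal K[X]) : Set K[X]) ∩ (monadic (ofPoly K f hf) : Set K[X]) =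
      {z : K[X] | ∃ h ∈ monadic (ofPoly K f hf),
        z = C ((algebraMap R K (eElem Q (ofPoly K f hf) g))⁻¹) * g * h} ∩
      (monadic (ofPoly K f hf) : Set K[X]) := by
  have he : algebraMap R K (eElem Q (ofPoly K f hf) g) ≠ 0 := by
    simpa using eElem_ne_zero hQ (ofPoly K f hf) g
  ext z
  refine and_congr_left fun hz => ⟨fun hgz => ?_, ?_⟩
  · obtain ⟨h, hh, heq⟩ := exists_eElem_mul_eq hQ hg hz (Ideal.mem_span_singleton.1 hgz)
    refine ⟨h, hh, ?_⟩
    rw [mul_assoc, ← heq, ← mul_assoc, ← C_mul, inv_mul_cancel₀ he, C_1, one_mul]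
  · rintro ⟨h, -, rfl⟩
    exact Ideal.mem_span_singleton.2 ((dvd_mul_left g _).mul_right h)

end Contraction

end MonadicInt

theorem proposition3p7 {R K : Type*} [CommRing R] [IsDomain R] [UniqueFactorizationMonoid R]
    [Field K] [Algebra R K] [IsFractionRing R K]
    (Q : Set R) (hQ : MonadicInt.IsRepSystem Q {p : R | Irreducible p})
    (f : R[X]) (hf : f ≠ 0) (F : MonadicInt.nonzeroInt R K)
    (hF : F = MonadicInt.ofPoly K f hf) :
    (∀ g ∈ MonadicInt.monadic F,
      ((Ideal.span {g} : Ideal K[X]) : Set K[X]) ∩ (MonadicInt.monadic F : Set K[X]) =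
          {z : K[X] | ∃ h ∈ MonadicInt.monadic F,
            z = C ((algebraMap R K (MonadicInt.eElem Q F g))⁻¹) * g * h} ∩
          (MonadicInt.monadic F : Set K[X]) ∧
      MonadicInt.IsVIdeal (MonadicInt.contraction F g) ∧
      (Irreducible g →
        MonadicInt.contraction F g ∈ MonadicInt.heightOnePrimes (MonadicInt.monadic F))) ∧
    MonadicInt.primesAvoidingConstants F =
      {P | ∃ t ∈ MonadicInt.nonconstantAtoms F,
        P = MonadicInt.contraction F (t.map (algebraMap R K))} ∧
    MonadicInt.primesAvoidingConstants F =
      {P | ∃ g ∈ MonadicInt.monadic F, Irreducible g ∧ P = MonadicInt.contraction F g} ∧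
    MonadicInt.nonconstantAtoms F =
      {t : R[X] | Irreducible t ∧ (∀ r : R, t ≠ C r) ∧ t ∣ f} ∧
    (∀ S : Set R[X], MonadicInt.IsRepSystem S (MonadicInt.nonconstantAtoms F) →
      Set.BijOn (fun t => MonadicInt.contraction F (t.map (algebraMap R K))) S
        (MonadicInt.primesAvoidingConstants F)) := by
  subst hF
  refine ⟨fun g hg => ⟨MonadicInt.span_inter_monadic hQ hg, MonadicInt.isVIdeal_contraction hQ hg,
    MonadicInt.contraction_mem_heightOnePrimes hQ hg⟩, ?_, ?_, MonadicInt.nonconstantAtoms_eq,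
    fun S hS => MonadicInt.bijOn_contraction hQ hS⟩
  · refine Set.Subset.antisymm (fun P hP =>
      MonadicInt.exists_nonconstantAtom_of_mem_primesAvoidingConstants hQ hP) ?_
    rintro _ ⟨t, ht, rfl⟩
    exact MonadicInt.contraction_mem_primesAvoidingConstants hQ ht.1
      (MonadicInt.irreducible_map_of_mem_nonconstantAtoms ht)
  · refine Set.Subset.antisymm (fun P hP => ?_) ?_
    · obtain ⟨t, ht, rfl⟩ :=
        MonadicInt.exists_nonconstantAtom_of_mem_primesAvoidingConstants hQ hP
      exact ⟨_, ht.1, MonadicInt.irreducible_map_of_mem_nonconstantAtoms ht, rfl⟩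
    · rintro _ ⟨g, hg, hirr, rfl⟩
      exact MonadicInt.contraction_mem_primesAvoidingConstants hQ hg hirr
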